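/- Let $\Omega\subset\mathbb{R}^n$ be a bounded open set (for instance a polyhedral domain), $d\ge 0$, $X=H^1_0(\Omega)^d$ (the closure of $C_c^\infty(\Omega)^d$ in $H^1$), and let $\|\cdot\|$, $(\cdot,\cdot)$ denote the norm and inner product of $L^2(\Omega)^d$. For $\delta>0$ the differential filter $G:L^2(\Omega)^d\to X$ maps $u$ to the unique $\bar u\in X$ with $\delta^2(\nabla\bar u,\nabla v)+(\bar u,v)=(u,v)$ for all $v\in X$; for a finite dimensional subspace $X^h\subset X$ the discrete filter $G^h:L^2(\Omega)^d\to X^h$ maps $u$ to the unique $w\in X^h$ with $\delta^2(\nabla w,\nabla v)+(w,v)=(u,v)$ for all $v\in X^h$. For $0<\alpha\le 1$ the Mitlar operators $D_{\alpha,j}$ on $L^2(\Omega)^d$ are defined by $D_{\alpha,j}\bar u=u_j$, where $[(1-\alpha)G+\alpha I]u_0=\bar u$ and $[(1-\alpha)G+\alpha I](u_j-u_{j-1})=\bar u-Gu_{j-1}$ for $j\ge1$; the discrete Mitlar operators $D^h_j:X^h\to X^h$ are defined in the same way from $G^h:X^h\to X^h$. For $k\ge 0$ and $h>0$, say that $X^h$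 has the approximation property with constant $K$ if for every $w\in X\cap H^{k+1}(\Omega)^d$ there is $v\in X^h$ with $\|w-v\|\le Kh^{k+1}\|w\|_{H^{k+1}(\Omega)}$ and $\|w-v\|_{H^1(\Omega)}\le Kh^{k}\|w\|_{H^{k+1}(\Omega)}$. Given $\Omega$, $d$, $k$, an integer $J\ge 0$ and $K$, there is a constant $C>0$ such that the following holds for all finite dimensional subspaces $X^h\subset X$, all $0<\alpha\le1$ and all $\delta>0$. (i) $\|D^h_J\|\le \frac{J+1}{\alpha}$, as an operator on $X^h$ with the $L^2$ norm. (ii) Let $h>0$ be such that $X^h$ has the approximation property with constant $K$, and let $u$ satisfy $\Delta^j u\in X$ for $0\le j\le J$, $\Delta^{J+1}u\in L^2(\Omega)^d$ (distributional Laplacians) and $D_{\alpha,j}Gu\in H^{k+1}(\Omega)^d$ for $0\le j\le J$. If $\varepsilon,\bar u^h\in X^h$ satisfy $\|\varepsilon\|\le\epsilon_0$ and $G^hu=\bar u^h+\varepsilon$, then $$\|u-D^h_J\bar u^h\|\le\frac{J+1}{\alpha}\,\epsilon_0+(\alpha\delta^2)^{J+1}\|\Delta^{J+1}u\|+C\left(\sqrt{\alpha}\,\delta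 h^k+h^{k+1}\right)\max_{0\le j\le J}\|D_{\alpha,j}Gu\|_{H^{k+1}(\Omega)}.$$ -/

import Mathlib

open MeasureTheory
open scoped ContDiff InnerProductSpace

noncomputable section

namespace Mitlar

/-! ### Lebesgue and Sobolev spaces of vector fields -/

/-- `L²(Ω)^d` for `Ω ⊆ ℝⁿ`, with its usual norm and inner product. -/
abbrev L2 {n : ℕ} (Ω : Set (EuclideanSpace ℝ (Fin n))) (d : ℕ) : Type :=
  Lp (EuclideanSpace ℝ (Fin d)) 2 (volume.restrict Ω)

/-- The classical partial derivative `∂_i φ`. -/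
def partialDeriv {n : ℕ} {F : Type*} [NormedAddCommGroup F] [NormedSpace ℝ F] (i : Fin n)
    (φ : EuclideanSpace ℝ (Fin n) → F) (x : EuclideanSpace ℝ (Fin n)) : F :=
  fderiv ℝ φ x (EuclideanSpace.single i 1)

/-- The classical mixed partial derivative `∂^β φ` for a multi-index `β`. -/
def multiDeriv {n : ℕ} {F : Type*} [NormedAddCommGroup F] [NormedSpace ℝ F] (β : Fin n → ℕ)
    (φ : EuclideanSpace ℝ (Fin n) → F) : EuclideanSpace ℝ (Fin n) → F :=
  (List.finRange n).foldr (fun i ψ => (partialDeriv i)^[β i] ψ) φ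

/-- `φ ∈ C_c^∞(Ω; F)`. -/
def IsTest {n : ℕ} {F : Type*} [NormedAddCommGroup F] [NormedSpace ℝ F]
    (Ω : Set (EuclideanSpace ℝ (Fin n))) (φ : EuclideanSpace ℝ (Fin n) → F) : Prop :=
  ContDiff ℝ ∞ φ ∧ HasCompactSupport φ ∧ tsupport φ ⊆ Ω

section
variable {n d : ℕ} {Ω : Set (EuclideanSpace ℝ (Fin n))}

/-- `g ∈ L²(Ω)^d` is the weak derivative `∂^β f` of `f ∈ L²(Ω)^d`. -/
def HasWeakDeriv (β : Fin n → ℕ) (f g : L2 Ω d) : Prop :=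
  ∀ φ : EuclideanSpace ℝ (Fin n) → ℝ, IsTest Ω φ →
    ∫ x in Ω, multiDeriv β φ x • f x = (-1 : ℝ) ^ (∑ i, β i) • ∫ x in Ω, φ x • g x

open Classical in
/-- The weak derivative `∂^β f` (with value `0` if `f` has none in `L²`). -/
def weakDeriv (β : Fin n → ℕ) (f : L2 Ω d) : L2 Ω d :=
  if h : ∃ g, HasWeakDeriv β f g then h.choose else 0

/-- `f ∈ H^m(Ω)^d`. -/
def MemSobolev (m : ℕ) (f : L2 Ω d) : Prop :=
  ∀ β : Fin n → ℕ, ∑ i, β i ≤ m → ∃ g, HasWeakDeriv β f g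

/-- The norm `‖f‖_{H^m(Ω)} = (∑_{|β| ≤ m} ‖∂^β f‖²)^{1/2}` of `f ∈ H^m(Ω)^d`. -/
def sobolevNorm (m : ℕ) (f : L2 Ω d) : ℝ :=
  √(∑ l ∈ Finset.range (m + 1), ∑ β ∈ Finset.Nat.antidiagonalTuple n l, ‖weakDeriv β f‖ ^ 2)

/-- `g ∈ L²(Ω)^d` is the distributional Laplacian of `f ∈ L²(Ω)^d`. -/
def HasLaplacian (f g : L2 Ω d) : Prop :=
  ∀ φ : EuclideanSpace ℝ (Fin n) → ℝ, IsTest Ω φ →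
    ∫ x in Ω, Laplacian.laplacian φ x • f x = ∫ x in Ω, φ x • g x

open Classical in
/-- The distributional Laplacian `Δ f` (with value `0` if it is not in `L²`). -/
def lap (f : L2 Ω d) : L2 Ω d :=
  if h : ∃ g, HasLaplacian f g then h.choose else 0

end

/-! ### The space `H^1_0(Ω)^d` -/

/-- Pairs `(v, ∇v)`: the component `none` is the function, the component `some i` the `i`-th
partial derivative; the norm is the `H^1` norm. -/
abbrev Jet {n : ℕ} (Ω : Set (EuclideanSpace ℝ (Fin n))) (d : ℕ) : Type :=
  PiLp 2 (fun _ : Option (Fin n) => L2 Ω d)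

/-- The component map `(v, ∇v) ↦ v` resp. `(v, ∇v) ↦ ∂_i v`. -/
abbrev comp {n : ℕ} (Ω : Set (EuclideanSpace ℝ (Fin n))) (d : ℕ) (o : Option (Fin n)) :
    Jet Ω d →L[ℝ] L2 Ω d :=
  PiLp.proj 2 (fun _ : Option (Fin n) => L2 Ω d) o

/-- All `(v, ∇v)` with `v ∈ H^1_0(Ω)^d`: the closure in the `H^1` norm of
`{(φ, ∇φ) : φ ∈ C_c^∞(Ω)^d}` (which is a linear space, so `span` does not enlarge it). -/
def jetH10 {n : ℕ} (Ω : Set (EuclideanSpace ℝ (Fin n))) (d : ℕ) : Submodule ℝ (Jet Ω d) :=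
  (Submodule.span ℝ {p : Jet Ω d | ∃ φ : EuclideanSpace ℝ (Fin n) → EuclideanSpace ℝ (Fin d),
    IsTest Ω φ ∧ p none =ᵐ[volume.restrict Ω] φ ∧
      ∀ i, p (some i) =ᵐ[volume.restrict Ω] partialDeriv i φ}).topologicalClosure

/-- `X = H^1_0(Ω)^d`, as a subspace of `L²(Ω)^d`. -/
def H10 {n : ℕ} (Ω : Set (EuclideanSpace ℝ (Fin n))) (d : ℕ) : Submodule ℝ (L2 Ω d) :=
  (jetH10 Ω d).map (comp Ω d none).toLinearMap

section
variable {n d : ℕ} {Ω : Set (EuclideanSpace ℝ (Fin n))}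

/-- All `(v, ∇v)` with `v ∈ H^1_0(Ω)^d ∩ Y`. -/
def jetOver (Y : Submodule ℝ (L2 Ω d)) : Submodule ℝ (Jet Ω d) :=
  jetH10 Ω d ⊓ Y.comap (comp Ω d none).toLinearMap

instance completeSpace_jetH10 : CompleteSpace (jetH10 Ω d) :=
  (Submodule.isClosed_topologicalClosure _).completeSpace_coe

instance completeSpace_jetOver (Y : Submodule ℝ (L2 Ω d)) [FiniteDimensional ℝ Y] :
    CompleteSpace (jetOver Y) := by
  have h : IsClosed ((jetOver Y : Submodule ℝ (Jet Ω d)) : Set (Jet Ω d)) :=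
    (Submodule.isClosed_topologicalClosure _).inter
      ((Submodule.closed_of_finiteDimensional Y).preimage (comp Ω d none).continuous)
  exact h.completeSpace_coe

/-! ### The differential filter -/

/-- The bilinear form `δ² (∇w, ∇v) + (w, v)` on a space `W` of pairs `(v, ∇v)`. -/
def filterForm (W : Submodule ℝ (Jet Ω d)) (δ : ℝ) : W →L[ℝ] W →L[ℝ] ℝ :=
  δ ^ 2 • ∑ i, (innerSL ℝ).bilinearComp ((comp Ω d (some i)).comp W.subtypeL)
      ((comp Ω d (some i)).comp W.subtypeL)
    + (innerSL ℝ).bilinearComp ((comp Ω d none).comp W.subtypeL) ((comp Ω d none).comp W.subtypeL)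

theorem filterForm_apply (W : Submodule ℝ (Jet Ω d)) (δ : ℝ) (w v : W) :
    filterForm W δ w v
      = δ ^ 2 * ∑ i, ⟪(w : Jet Ω d) (some i), (v : Jet Ω d) (some i)⟫_ℝ
        + ⟪(w : Jet Ω d) none, (v : Jet Ω d) none⟫_ℝ := by
  simp [filterForm]

theorem isCoercive_filterForm (W : Submodule ℝ (Jet Ω d)) {δ : ℝ} (hδ : 0 < δ) :
    IsCoercive (filterForm W δ) := by
  refine ⟨min 1 (δ ^ 2), by positivity, fun w => ?_⟩
  have h1 : ‖w‖ * ‖w‖ = ∑ i, ‖(w : Jet Ω d) (some i)‖ ^ 2 + ‖(w : Jet Ω d) none‖ ^ 2 := by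
    rw [← sq, ← Submodule.norm_coe, PiLp.norm_sq_eq_of_L2, Fintype.sum_option, add_comm]
  rw [filterForm_apply, mul_assoc, h1]
  simp only [real_inner_self_eq_norm_sq]
  have hS : 0 ≤ ∑ i, ‖(w : Jet Ω d) (some i)‖ ^ 2 := Finset.sum_nonneg fun i _ => by positivity
  nlinarith [min_le_left 1 (δ ^ 2), min_le_right 1 (δ ^ 2), sq_nonneg ‖(w : Jet Ω d) none‖]

/-- For `u ∈ L²(Ω)^d`, the solution `w ∈ W` (furnished by the Lax–Milgram theorem) of
`δ² (∇w, ∇v) + (w, v) = (u, v)` for all `v ∈ W`. -/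
def filterSol (W : Submodule ℝ (Jet Ω d)) [CompleteSpace W] (δ : ℝ) (hδ : 0 < δ) :
    L2 Ω d →L[ℝ] W :=
  ((isCoercive_filterForm W hδ).continuousLinearEquivOfBilin.symm : W →L[ℝ] W).comp
    (ContinuousLinearMap.adjoint ((comp Ω d none).comp W.subtypeL))

/-- `filterSol` is the unique solution of the variational problem. -/
theorem eq_filterSol_iff (W : Submodule ℝ (Jet Ω d)) [CompleteSpace W] (δ : ℝ) (hδ : 0 < δ)
    (u : L2 Ω d) (w : W) :
    w = filterSol W δ hδ u ↔
      ∀ v : W, δ ^ 2 * ∑ i, ⟪(w : Jet Ω d) (some i), (v : Jet Ω d) (some i)⟫_ℝ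
        + ⟪(w : Jet Ω d) none, (v : Jet Ω d) none⟫_ℝ = ⟪u, (v : Jet Ω d) none⟫_ℝ := by
  have key : w = filterSol W δ hδ u ↔ (isCoercive_filterForm W hδ).continuousLinearEquivOfBilin w
      = ContinuousLinearMap.adjoint ((comp Ω d none).comp W.subtypeL) u :=
    (ContinuousLinearEquiv.eq_symm_apply _)
  rw [key]
  constructor
  · intro h v
    rw [← filterForm_apply, ← IsCoercive.continuousLinearEquivOfBilin_apply
      (isCoercive_filterForm W hδ), h, ContinuousLinearMap.adjoint_inner_left]
    rfl
  · intro h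
    refine ext_inner_right ℝ fun v => ?_
    rw [IsCoercive.continuousLinearEquivOfBilin_apply, filterForm_apply, h v,
      ContinuousLinearMap.adjoint_inner_left]
    rfl

/-- The differential filter `G : L²(Ω)^d → L²(Ω)^d` with filter radius `δ`: `ū = G u` is the
element of `H^1_0(Ω)^d` with `δ² (∇ū, ∇v) + (ū, v) = (u, v)` for all `v ∈ H^1_0(Ω)^d`. -/
def diffFilter (Ω : Set (EuclideanSpace ℝ (Fin n))) (d : ℕ) (δ : ℝ) (hδ : 0 < δ) :
    L2 Ω d →L[ℝ] L2 Ω d :=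
  ((comp Ω d none).comp (jetH10 Ω d).subtypeL).comp (filterSol (jetH10 Ω d) δ hδ)

/-- The discrete differential filter `G^h : L²(Ω)^d → X^h`: for a finite dimensional subspace
`X^h` of `H^1_0(Ω)^d`, `ū^h = G^h u` is the element of `X^h` with
`δ² (∇ū^h, ∇v^h) + (ū^h, v^h) = (u, v^h)` for all `v^h ∈ X^h`. -/
def discFilter (Xh : Submodule ℝ (L2 Ω d)) [FiniteDimensional ℝ Xh] (δ : ℝ) (hδ : 0 < δ) :
    L2 Ω d →L[ℝ] Xh :=
  (((comp Ω d none).comp (jetOver Xh).subtypeL).comp (filterSol (jetOver Xh) δ hδ)).codRestrict Xh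
    (fun u => (filterSol (jetOver Xh) δ hδ u).2.2)

end

/-! ### Modified iterated Tikhonov–Lavrentiev regularization -/

/-- `D_α = [(1 - α) G + α I]⁻¹`, an operator on the space on which `G` acts. -/
def regOp {H : Type*} [NormedAddCommGroup H] [NormedSpace ℝ H] (G : H →L[ℝ] H) (α : ℝ) :
    H →L[ℝ] H :=
  Ring.inverse ((1 - α) • G + α • (1 : H →L[ℝ] H))

/-- The operators `D_{α,j} : ū ↦ u_j`, where `[(1 - α) G + α I] u_0 = ū` and
`[(1 - α) G + α I] (u_j - u_{j-1}) = ū - G u_{j-1}` for `j ≥ 1`. -/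
def iterOp {H : Type*} [NormedAddCommGroup H] [NormedSpace ℝ H] (G : H →L[ℝ] H) (α : ℝ) :
    ℕ → (H →L[ℝ] H)
  | 0 => regOp G α
  | j + 1 => iterOp G α j + regOp G α * (1 - G * iterOp G α j)

section
variable {n d : ℕ} {Ω : Set (EuclideanSpace ℝ (Fin n))}

/-- The continuous Mitlar operators `D_{α,j}` of the differential filter. -/
def contMitlar (Ω : Set (EuclideanSpace ℝ (Fin n))) (d : ℕ) (δ : ℝ) (hδ : 0 < δ) (α : ℝ) (j : ℕ) :
    L2 Ω d →L[ℝ] L2 Ω d :=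
  iterOp (diffFilter Ω d δ hδ) α j

/-- The discrete Mitlar operators `D^h_j : X^h → X^h`, built from `G^h : X^h → X^h`. -/
def discMitlar (Xh : Submodule ℝ (L2 Ω d)) [FiniteDimensional ℝ Xh] (δ : ℝ) (hδ : 0 < δ) (α : ℝ)
    (j : ℕ) : Xh →L[ℝ] Xh :=
  iterOp ((discFilter Xh δ hδ).comp Xh.subtypeL) α j

/-- The approximation property of order `k` of `X^h` for the mesh size `h`, with constant `K`:
every `w ∈ H^1_0 ∩ H^{k+1}` has an approximation `v ∈ X^h` with
`‖w - v‖_{L²} ≤ K h^{k+1} ‖w‖_{H^{k+1}}` and `‖w - v‖_{H^1} ≤ K h^k ‖w‖_{H^{k+1}}`. -/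
def ApproxProperty (Xh : Submodule ℝ (L2 Ω d)) (k : ℕ) (K h : ℝ) : Prop :=
  ∀ w ∈ H10 Ω d, MemSobolev (k + 1) w → ∃ v ∈ Xh,
    ‖w - v‖ ≤ K * h ^ (k + 1) * sobolevNorm (k + 1) w ∧
    sobolevNorm 1 (w - v) ≤ K * h ^ k * sobolevNorm (k + 1) w

end

end Mitlar

end

noncomputable section

namespace Mitlar


/-! ### Lavrentiev regularization of a monotone operator -/

section Regularization
variable {H : Type*} [NormedAddCommGroup H] [InnerProductSpace ℝ H]

/-! Let S be the filter of radius √α δ. Its variational equation gives [(1 - α) G + α I] S = G, that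
is D_α G = S (`lavrentiev_filterSol`). So u_j = D_{α,j} G u satisfies u_0 = S u and u_{j+1} = u_j +
S (u - u_j). The same computation in X^h gives this recursion for D^h_j G^h u, with the Galerkin
filter S^h in place of S.

Stability: monotonicity of G^h bounds its regularized inverse by 1/α, and I - S^h is nonexpansive,
so each iteration adds at most 1/α to the norm (`norm_iterOp_apply_le`).

Regularization error: u - u_J = (I - S)^{J+1} u, and Green's formula gives (I - S) f = -αδ² S Δf for
f in H^1_0 with Δf in L². Iterating, with ‖S‖ ≤ 1, yields the factor (αδ²)^{J+1}
(`norm_sub_iterJet_le`).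

Discretization error: e_j = u_j - u_j^h satisfies e_{j+1} = (I - S^h) e_j + (S - S^h)(u - u_j).
Since S (u - u_j) = u_{j+1} - u_j, Céa's lemma in the energy norm of radius √α δ bounds the last
term by the approximation errors of u_j and u_{j+1} (`norm_iterJet_sub_le`). -/

theorem mul_norm_le_norm_lavrentiev {G : H →L[ℝ] H} (hG : ∀ x, 0 ≤ ⟪G x, x⟫_ℝ) {α : ℝ}
    (hα1 : α ≤ 1) (x : H) :
    α * ‖x‖ ≤ ‖((1 - α) • G + α • (1 : H →L[ℝ] H)) x‖ := by
  rcases eq_or_ne x 0 with rfl | hx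
  · simp
  have hx' : 0 < ‖x‖ := norm_pos_iff.2 hx
  have h1 := real_inner_le_norm (((1 - α) • G + α • (1 : H →L[ℝ] H)) x) x
  have h2 : ⟪((1 - α) • G + α • (1 : H →L[ℝ] H)) x, x⟫_ℝ
      = (1 - α) * ⟪G x, x⟫_ℝ + α * ‖x‖ ^ 2 := by
    simp [inner_add_left, real_inner_smul_left]
  have h3 := mul_nonneg (sub_nonneg.2 hα1) (hG x)
  -- Monotonicity gives α ‖x‖² ≤ (T x, x) for the regularized operator T, and Cauchy–Schwarz bounds
  -- the right side by ‖T x‖ ‖x‖.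
  refine le_of_mul_le_mul_right ?_ hx'
  nlinarith

theorem iterOp_succ_apply (G : H →L[ℝ] H) (α : ℝ) (j : ℕ) (y : H) :
    iterOp G α (j + 1) y = iterOp G α j y + regOp G α (y - G (iterOp G α j y)) := by
  simp [iterOp]

variable [CompleteSpace H]

/-- Monotonicity makes the form (T x, y) coercive with constant α, so Lax–Milgram applies.
Invertibility has to be known before `regOp` can be used, since `Ring.inverse` is 0 at a non-unit.
-/
theorem isUnit_lavrentiev {G : H →L[ℝ] H} (hG : ∀ x, 0 ≤ ⟪G x, x⟫_ℝ) {α : ℝ} (hα : 0 < α)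
    (hα1 : α ≤ 1) : IsUnit ((1 - α) • G + α • (1 : H →L[ℝ] H)) := by
  set T : H →L[ℝ] H := (1 - α) • G + α • (1 : H →L[ℝ] H) with hT
  have hc : IsCoercive ((innerSL ℝ).comp T) := by
    refine ⟨α, hα, fun x => ?_⟩
    have h3 := mul_nonneg (sub_nonneg.2 hα1) (hG x)
    have h2 : ((innerSL ℝ).comp T) x x = (1 - α) * ⟪G x, x⟫_ℝ + α * ‖x‖ ^ 2 := by
      simp [hT]
    rw [h2]; nlinarith
  have he : (hc.continuousLinearEquivOfBilin : H →L[ℝ] H) = T := by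
    ext x
    refine ext_inner_right ℝ fun v => ?_
    simp [IsCoercive.continuousLinearEquivOfBilin_apply]
  rw [← he]
  exact (ContinuousLinearEquiv.toUnit hc.continuousLinearEquivOfBilin).isUnit

theorem lavrentiev_regOp {G : H →L[ℝ] H} (hG : ∀ x, 0 ≤ ⟪G x, x⟫_ℝ) {α : ℝ} (hα : 0 < α)
    (hα1 : α ≤ 1) (y : H) : ((1 - α) • G + α • (1 : H →L[ℝ] H)) (regOp G α y) = y :=
  congrArg (fun A : H →L[ℝ] H => A y) (Ring.mul_inverse_cancel _ (isUnit_lavrentiev hG hα hα1))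

theorem regOp_lavrentiev {G : H →L[ℝ] H} (hG : ∀ x, 0 ≤ ⟪G x, x⟫_ℝ) {α : ℝ} (hα : 0 < α)
    (hα1 : α ≤ 1) (x : H) : regOp G α (((1 - α) • G + α • (1 : H →L[ℝ] H)) x) = x :=
  congrArg (fun A : H →L[ℝ] H => A x) (Ring.inverse_mul_cancel _ (isUnit_lavrentiev hG hα hα1))

theorem norm_regOp_apply_le {G : H →L[ℝ] H} (hG : ∀ x, 0 ≤ ⟪G x, x⟫_ℝ) {α : ℝ} (hα : 0 < α)
    (hα1 : α ≤ 1) (y : H) : ‖regOp G α y‖ ≤ 1 / α * ‖y‖ := by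
  have h := mul_norm_le_norm_lavrentiev hG hα1 (regOp G α y)
  rw [lavrentiev_regOp hG hα hα1] at h
  rw [one_div, inv_mul_eq_div, le_div_iff₀ hα]
  linarith

/-- The recursion reads D_{j+1} = (I - D_α G) D_j + D_α: the first factor is nonexpansive by `hS`,
and the second term costs 1/α. -/
theorem norm_iterOp_apply_le {G : H →L[ℝ] H} (hG : ∀ x, 0 ≤ ⟪G x, x⟫_ℝ) {α : ℝ} (hα : 0 < α)
    (hα1 : α ≤ 1) (hS : ∀ x, ‖x - regOp G α (G x)‖ ≤ ‖x‖) (j : ℕ) (y : H) :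
    ‖iterOp G α j y‖ ≤ ((j : ℝ) + 1) / α * ‖y‖ := by
  induction j with
  | zero => simpa [iterOp] using norm_regOp_apply_le hG hα hα1 y
  | succ j ih =>
    have h1 : iterOp G α (j + 1) y = (iterOp G α j y - regOp G α (G (iterOp G α j y)))
        + regOp G α y := by
      rw [iterOp_succ_apply, map_sub]; abel
    calc ‖iterOp G α (j + 1) y‖
        ≤ ‖iterOp G α j y - regOp G α (G (iterOp G α j y))‖ + ‖regOp G α y‖ := by
          rw [h1]; exact norm_add_le _ _
      _ ≤ ((j : ℝ) + 1) / α * ‖y‖ + 1 / α * ‖y‖ :=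
          add_le_add ((hS _).trans ih) (norm_regOp_apply_le hG hα hα1 y)
      _ = (((j + 1 : ℕ) : ℝ) + 1) / α * ‖y‖ := by push_cast; ring

end Regularization

/-! ### The filter of a space of jets -/

section Filter
variable {n d : ℕ} {Ω : Set (EuclideanSpace ℝ (Fin n))}

/-- The squared energy norm `δ² ‖∇v‖² + ‖v‖²`. -/
def energy (δ : ℝ) (p : Jet Ω d) : ℝ := δ ^ 2 * ∑ i, ‖p (some i)‖ ^ 2 + ‖p none‖ ^ 2

/-- The energy inner product `δ² (∇w, ∇v) + (w, v)`. -/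
def energyInner (δ : ℝ) (p q : Jet Ω d) : ℝ :=
  δ ^ 2 * ∑ i, ⟪p (some i), q (some i)⟫_ℝ + ⟪p none, q none⟫_ℝ

theorem energyInner_self (δ : ℝ) (p : Jet Ω d) : energyInner δ p p = energy δ p := by
  simp [energyInner, energy]

theorem energyInner_add_left (δ : ℝ) (p q r : Jet Ω d) :
    energyInner δ (p + q) r = energyInner δ p r + energyInner δ q r := by
  simp only [energyInner, PiLp.add_apply, inner_add_left, Finset.sum_add_distrib]; ring

theorem energyInner_smul_left (δ c : ℝ) (p r : Jet Ω d) :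
    energyInner δ (c • p) r = c * energyInner δ p r := by
  simp only [energyInner, PiLp.smul_apply, real_inner_smul_left, ← Finset.mul_sum]; ring

theorem energyInner_sub_left (δ : ℝ) (p q r : Jet Ω d) :
    energyInner δ (p - q) r = energyInner δ p r - energyInner δ q r := by
  simp only [energyInner, PiLp.sub_apply, inner_sub_left, Finset.sum_sub_distrib]; ring

theorem energy_sub (δ : ℝ) (p q : Jet Ω d) :
    energy δ (p - q) = energy δ p - 2 * energyInner δ p q + energy δ q := by
  simp only [energy, energyInner, PiLp.sub_apply, norm_sub_sq_real, Finset.sum_sub_distrib,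
    Finset.sum_add_distrib, ← Finset.mul_sum]; ring

theorem energy_add (δ : ℝ) (p q : Jet Ω d) :
    energy δ (p + q) = energy δ p + 2 * energyInner δ p q + energy δ q := by
  simp only [energy, energyInner, PiLp.add_apply, norm_add_sq_real,
    Finset.sum_add_distrib, ← Finset.mul_sum]; ring

theorem energy_nonneg (δ : ℝ) (p : Jet Ω d) : 0 ≤ energy δ p := by
  unfold energy; positivity

theorem norm_sq_le_energy (δ : ℝ) (p : Jet Ω d) : ‖p none‖ ^ 2 ≤ energy δ p := by
  have : 0 ≤ δ ^ 2 * ∑ i, ‖p (some i)‖ ^ 2 := by positivity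
  unfold energy; linarith

theorem energy_sub_le (δ : ℝ) (p q : Jet Ω d) :
    energy δ (p - q) ≤ 2 * energy δ p + 2 * energy δ q := by
  have h1 := energy_sub δ p q
  have h2 := energy_add δ p q
  have h3 := energy_nonneg δ (p + q)
  linarith

variable (W : Submodule ℝ (Jet Ω d)) [CompleteSpace W]

theorem eq_filterSol_iff_energyInner {δ : ℝ} (hδ : 0 < δ) (u : L2 Ω d) (w : W) :
    w = filterSol W δ hδ u ↔ ∀ v : W, energyInner δ (w : Jet Ω d) v = ⟪u, (v : Jet Ω d) none⟫_ℝ :=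
  eq_filterSol_iff W δ hδ u w

theorem energyInner_filterSol {δ : ℝ} (hδ : 0 < δ) (u : L2 Ω d) {v : Jet Ω d} (hv : v ∈ W) :
    energyInner δ (filterSol W δ hδ u : Jet Ω d) v = ⟪u, v none⟫_ℝ :=
  (eq_filterSol_iff_energyInner W hδ u _).1 rfl ⟨v, hv⟩

/-- The function component of `filterSol`. -/
def filterFn (δ : ℝ) (hδ : 0 < δ) : L2 Ω d →L[ℝ] L2 Ω d :=
  ((comp Ω d none).comp W.subtypeL).comp (filterSol W δ hδ)

theorem filterFn_apply {δ : ℝ} (hδ : 0 < δ) (u : L2 Ω d) :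
    filterFn W δ hδ u = (filterSol W δ hδ u : Jet Ω d) none := rfl

/-- The solution itself is the test function. This one inequality gives positivity of S and the
nonexpansiveness of both S and I - S. -/
theorem norm_filterFn_sq_le {δ : ℝ} (hδ : 0 < δ) (u : L2 Ω d) :
    ‖filterFn W δ hδ u‖ ^ 2 ≤ ⟪u, filterFn W δ hδ u⟫_ℝ := by
  have h := energyInner_filterSol W hδ u (filterSol W δ hδ u).2
  rw [energyInner_self] at h
  rw [filterFn_apply, ← h]
  exact norm_sq_le_energy _ _

theorem inner_filterFn_nonneg {δ : ℝ} (hδ : 0 < δ) (u : L2 Ω d) :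
    0 ≤ ⟪filterFn W δ hδ u, u⟫_ℝ := by
  rw [real_inner_comm]
  exact (sq_nonneg _).trans (norm_filterFn_sq_le W hδ u)

theorem norm_filterFn_le {δ : ℝ} (hδ : 0 < δ) (u : L2 Ω d) : ‖filterFn W δ hδ u‖ ≤ ‖u‖ := by
  have h1 := norm_filterFn_sq_le W hδ u
  have h2 := real_inner_le_norm u (filterFn W δ hδ u)
  by_contra! h
  nlinarith [norm_nonneg u]

theorem norm_sub_filterFn_le {δ : ℝ} (hδ : 0 < δ) (u : L2 Ω d) :
    ‖u - filterFn W δ hδ u‖ ≤ ‖u‖ := by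
  have h1 := norm_filterFn_sq_le W hδ u
  have h2 := norm_sub_sq_real u (filterFn W δ hδ u)
  refine le_of_sq_le_sq ?_ (norm_nonneg _)
  nlinarith [sq_nonneg ‖filterFn W δ hδ u‖]

/-- Lavrentiev regularization of the filter of radius `δ` gives the filter of radius `√α δ`. -/
theorem lavrentiev_filterSol {δ α : ℝ} (hδ : 0 < δ) (hα : 0 < α) (hδ' : 0 < √α * δ)
    (u : L2 Ω d) :
    (1 - α) • filterSol W δ hδ (filterFn W (√α * δ) hδ' u) + α • filterSol W (√α * δ) hδ' u
      = filterSol W δ hδ u := by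
  rw [eq_filterSol_iff_energyInner]
  intro v
  have h1 := energyInner_filterSol W hδ (filterFn W (√α * δ) hδ' u) v.2
  have h2 := energyInner_filterSol W hδ' u v.2
  simp only [Submodule.coe_add, Submodule.coe_smul, energyInner_add_left, energyInner_smul_left]
  -- The two L² terms, with weights 1 - α and α, add up to (S u, v), while the gradient term has
  -- weight αδ²: this is the energy form of radius √α δ.
  rw [h1, ← h2]
  simp only [energyInner, mul_pow, Real.sq_sqrt hα.le, filterFn_apply]
  ring

/-- The Galerkin solution is the best approximation in the energy norm. -/
theorem energy_filterSol_sub_le {V : Submodule ℝ (Jet Ω d)} [CompleteSpace V] (hVW : V ≤ W)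
    {δ : ℝ} (hδ : 0 < δ) (u : L2 Ω d) {v : Jet Ω d} (hv : v ∈ V) :
    energy δ ((filterSol W δ hδ u : Jet Ω d) - (filterSol V δ hδ u : Jet Ω d))
      ≤ energy δ ((filterSol W δ hδ u : Jet Ω d) - v) := by
  set w : Jet Ω d := (filterSol W δ hδ u : Jet Ω d)
  set wh : Jet Ω d := (filterSol V δ hδ u : Jet Ω d)
  have hz : v - wh ∈ V := V.sub_mem hv (filterSol V δ hδ u).2
  -- Galerkin orthogonality, then Pythagoras.
  have h0 : energyInner δ (w - wh) (v - wh) = 0 := by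
    rw [energyInner_sub_left, energyInner_filterSol W hδ u (hVW hz),
      energyInner_filterSol V hδ u hz, sub_self]
  have h1 := energy_sub δ (w - wh) (v - wh)
  rw [h0, sub_sub_sub_cancel_right] at h1
  linarith [energy_nonneg δ (v - wh)]

/-- The jets of the iterated regularizations `u_0 = S u`, `u_{j+1} = u_j + S (u - u_j)`, where `S`
is the filter of radius `δ` on `W`. -/
def iterJet (δ : ℝ) (hδ : 0 < δ) (u : L2 Ω d) : ℕ → W
  | 0 => filterSol W δ hδ u
  | j + 1 => iterJet δ hδ u j
      + filterSol W δ hδ (u - ((iterJet δ hδ u j : Jet Ω d) none))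

/-- Each step multiplies the residual by I - S; the exponent is j + 1 because u_0 = S u already
accounts for one step. -/
theorem sub_iterJet_none {δ : ℝ} (hδ : 0 < δ) (u : L2 Ω d) (j : ℕ) :
    u - (iterJet W δ hδ u j : Jet Ω d) none = ((1 - filterFn W δ hδ) ^ (j + 1)) u := by
  induction j with
  | zero => simp [iterJet, filterFn_apply]
  | succ j ih =>
    rw [pow_succ' _ (j + 1), mul_apply_eq_comp, ← ih]
    simp only [iterJet, Submodule.coe_add, PiLp.add_apply, sub_apply,
      one_apply_eq_self, filterFn_apply]
    abel

end Filter

/-! ### Mitlar operators as iterated filters of radius √α δ -/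

section MitlarOperators
variable {n d : ℕ} {Ω : Set (EuclideanSpace ℝ (Fin n))}

theorem regOp_diffFilter {δ α : ℝ} (hδ : 0 < δ) (hα : 0 < α) (hα1 : α ≤ 1) (hδ' : 0 < √α * δ)
    (u : L2 Ω d) :
    regOp (diffFilter Ω d δ hδ) α (diffFilter Ω d δ hδ u)
      = filterFn (jetH10 Ω d) (√α * δ) hδ' u := by
  have h := congrArg (fun p : jetH10 Ω d => (p : Jet Ω d) none)
    (lavrentiev_filterSol (jetH10 Ω d) hδ hα hδ' u)
  have h' : ((1 - α) • diffFilter Ω d δ hδ + α • (1 : L2 Ω d →L[ℝ] L2 Ω d))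
      (filterFn (jetH10 Ω d) (√α * δ) hδ' u) = diffFilter Ω d δ hδ u := h
  have hG : ∀ x, 0 ≤ ⟪diffFilter Ω d δ hδ x, x⟫_ℝ := inner_filterFn_nonneg (jetH10 Ω d) hδ
  rw [← h', regOp_lavrentiev hG hα hα1]

theorem contMitlar_diffFilter {δ α : ℝ} (hδ : 0 < δ) (hα : 0 < α) (hα1 : α ≤ 1)
    (hδ' : 0 < √α * δ) (u : L2 Ω d) (j : ℕ) :
    contMitlar Ω d δ hδ α j (diffFilter Ω d δ hδ u)
      = (iterJet (jetH10 Ω d) (√α * δ) hδ' u j : Jet Ω d) none := by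
  unfold contMitlar
  induction j with
  | zero => exact regOp_diffFilter hδ hα hα1 hδ' u
  | succ j ih =>
    rw [iterOp_succ_apply, ih, ← map_sub, regOp_diffFilter hδ hα hα1 hδ']
    rfl

variable (Xh : Submodule ℝ (L2 Ω d)) [FiniteDimensional ℝ Xh]

theorem inner_discFilter_nonneg {δ : ℝ} (hδ : 0 < δ) (x : Xh) :
    0 ≤ ⟪((discFilter Xh δ hδ).comp Xh.subtypeL) x, x⟫_ℝ :=
  inner_filterFn_nonneg (jetOver Xh) hδ (x : L2 Ω d)

/-- The datum u is any field in L², not only in X^h; this is what lets the discrete iteration start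
from G^h u. -/
theorem regOp_discFilter {δ α : ℝ} (hδ : 0 < δ) (hα : 0 < α) (hα1 : α ≤ 1) (hδ' : 0 < √α * δ)
    (u : L2 Ω d) :
    regOp ((discFilter Xh δ hδ).comp Xh.subtypeL) α (discFilter Xh δ hδ u)
      = discFilter Xh (√α * δ) hδ' u := by
  have h := congrArg (fun p : jetOver Xh => (p : Jet Ω d) none)
    (lavrentiev_filterSol (jetOver Xh) hδ hα hδ' u)
  have h' : ((1 - α) • (discFilter Xh δ hδ).comp Xh.subtypeL + α • (1 : Xh →L[ℝ] Xh))
      (discFilter Xh (√α * δ) hδ' u) = discFilter Xh δ hδ u := Subtype.ext h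
  rw [← h', regOp_lavrentiev (inner_discFilter_nonneg Xh hδ) hα hα1]

theorem discMitlar_discFilter {δ α : ℝ} (hδ : 0 < δ) (hα : 0 < α) (hα1 : α ≤ 1)
    (hδ' : 0 < √α * δ) (u : L2 Ω d) (j : ℕ) :
    (discMitlar Xh δ hδ α j (discFilter Xh δ hδ u) : L2 Ω d)
      = (iterJet (jetOver Xh) (√α * δ) hδ' u j : Jet Ω d) none := by
  unfold discMitlar
  induction j with
  | zero =>
    exact congrArg Subtype.val (regOp_discFilter Xh hδ hα hα1 hδ' u)
  | succ j ih =>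
    rw [iterOp_succ_apply, ContinuousLinearMap.comp_apply, ← map_sub,
      regOp_discFilter Xh hδ hα hα1 hδ', Submodule.coe_add, Submodule.subtypeL_apply, ih]
    rfl

theorem norm_discMitlar_apply_le {δ α : ℝ} (hδ : 0 < δ) (hα : 0 < α) (hα1 : α ≤ 1) (j : ℕ)
    (y : Xh) : ‖discMitlar Xh δ hδ α j y‖ ≤ ((j : ℝ) + 1) / α * ‖y‖ := by
  have hδ' : 0 < √α * δ := mul_pos (Real.sqrt_pos.2 hα) hδ
  refine norm_iterOp_apply_le (inner_discFilter_nonneg Xh hδ) hα hα1 (fun x => ?_) j y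
  rw [ContinuousLinearMap.comp_apply, regOp_discFilter Xh hδ hα hα1 hδ']
  exact norm_sub_filterFn_le (jetOver Xh) hδ' (x : L2 Ω d)

end MitlarOperators


/-! ### Test functions and weak derivatives -/

section WeakDerivatives
variable {n d : ℕ} {Ω : Set (EuclideanSpace ℝ (Fin n))}

section
variable {F : Type*} [NormedAddCommGroup F] [NormedSpace ℝ F]
  {φ : EuclideanSpace ℝ (Fin n) → F}

theorem IsTest.partialDeriv (hφ : IsTest Ω φ) (i : Fin n) : IsTest Ω (partialDeriv i φ) := by
  refine ⟨?_, hφ.2.1.fderiv_apply ℝ _, (tsupport_fderiv_apply_subset ℝ _).trans hφ.2.2⟩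
  have h : ContDiff ℝ ∞ (fderiv ℝ φ) := hφ.1.fderiv_right (by simp)
  exact h.clm_apply contDiff_const

theorem IsTest.memLp (hφ : IsTest Ω φ) : MemLp φ 2 (volume.restrict Ω) :=
  (hφ.1.continuous.memLp_of_hasCompactSupport hφ.2.1).restrict Ω

theorem IsTest.comp_clm {F' : Type*} [NormedAddCommGroup F'] [NormedSpace ℝ F']
    (hφ : IsTest Ω φ) (A : F →L[ℝ] F') : IsTest Ω (fun x => A (φ x)) :=
  ⟨A.contDiff.comp hφ.1, hφ.2.1.comp_left (map_zero A),
    (tsupport_comp_subset (map_zero A) φ).trans hφ.2.2⟩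

theorem partialDeriv_comp_clm {F' : Type*} [NormedAddCommGroup F'] [NormedSpace ℝ F']
    (hφ : Differentiable ℝ φ) (A : F →L[ℝ] F') (i : Fin n) :
    partialDeriv i (fun x => A (φ x)) = fun x => A (partialDeriv i φ x) := by
  ext x
  have h : HasFDerivAt (fun x => A (φ x)) (A.comp (fderiv ℝ φ x)) x :=
    A.hasFDerivAt.comp x (hφ x).hasFDerivAt
  simp only [partialDeriv, h.fderiv, ContinuousLinearMap.comp_apply]

theorem laplacian_eq_sum_partialDeriv (hφ : ContDiff ℝ ∞ φ) (x : EuclideanSpace ℝ (Fin n)) :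
    Laplacian.laplacian φ x = ∑ i, partialDeriv i (partialDeriv i φ) x := by
  rw [InnerProductSpace.laplacian_eq_iteratedFDeriv_orthonormalBasis φ
    (EuclideanSpace.basisFun (Fin n) ℝ)]
  refine Finset.sum_congr rfl fun i _ => ?_
  have h : DifferentiableAt ℝ (fderiv ℝ φ) x :=
    ((hφ.fderiv_right (m := ∞) (by simp)).differentiable (by simp)) x
  have h2 : HasFDerivAt (partialDeriv i φ) _ x :=
    (h.hasFDerivAt).clm_apply (hasFDerivAt_const (EuclideanSpace.single i (1 : ℝ)) x)
  rw [iteratedFDeriv_two_apply]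
  conv_rhs => rw [partialDeriv, h2.fderiv]
  simp

end

theorem integrable_test_smul {ψ : EuclideanSpace ℝ (Fin n) → ℝ} (hψ : IsTest Ω ψ) (f : L2 Ω d) :
    Integrable (fun x => ψ x • f x) (volume.restrict Ω) :=
  memLp_one_iff_integrable.1 ((Lp.memLp f).smul hψ.memLp)

/-- The class in `L²(Ω)^d` of a test field. -/
def testL2 {Φ : EuclideanSpace ℝ (Fin n) → EuclideanSpace ℝ (Fin d)} (hΦ : IsTest Ω Φ) : L2 Ω d :=
  hΦ.memLp.toLp Φ

theorem inner_testL2 {Φ : EuclideanSpace ℝ (Fin n) → EuclideanSpace ℝ (Fin d)} (hΦ : IsTest Ω Φ)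
    (f : L2 Ω d) : ⟪testL2 hΦ, f⟫_ℝ = ∫ x in Ω, ⟪Φ x, f x⟫_ℝ := by
  rw [L2.inner_def]
  refine integral_congr_ae ?_
  filter_upwards [hΦ.memLp.coeFn_toLp] with x hx
  rw [testL2, hx]

theorem inner_testL2_eq_sum {Φ : EuclideanSpace ℝ (Fin n) → EuclideanSpace ℝ (Fin d)}
    (hΦ : IsTest Ω Φ) (f : L2 Ω d) :
    ⟪testL2 hΦ, f⟫_ℝ = ∑ c, (∫ x in Ω, Φ x c • f x) c := by
  have hi : ∀ c, Integrable (fun x => Φ x c • f x) (volume.restrict Ω) := fun c =>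
    integrable_test_smul (hΦ.comp_clm (EuclideanSpace.proj c)) f
  have h : ∀ c, (∫ x in Ω, Φ x c • f x) c = ∫ x in Ω, Φ x c * f x c := fun c =>
    ((EuclideanSpace.proj (𝕜 := ℝ) c).integral_comp_comm (hi c)).symm
  rw [inner_testL2, Finset.sum_congr rfl fun c _ => h c, ← integral_finsetSum]
  · refine integral_congr_ae (.of_forall fun x => ?_)
    simp [PiLp.inner_apply, mul_comm]
  · intro c _
    exact (EuclideanSpace.proj (𝕜 := ℝ) c).integrable_comp (hi c)

theorem IsTest.smul_single {ψ : EuclideanSpace ℝ (Fin n) → ℝ} (hψ : IsTest Ω ψ) (c : Fin d) :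
    IsTest Ω (fun x => ψ x • EuclideanSpace.single c (1 : ℝ)) :=
  hψ.comp_clm ((1 : ℝ →L[ℝ] ℝ).smulRight (EuclideanSpace.single c (1 : ℝ)))

theorem inner_testL2_smul_single {ψ : EuclideanSpace ℝ (Fin n) → ℝ} (hψ : IsTest Ω ψ) (c : Fin d)
    (f : L2 Ω d) : ⟪testL2 (hψ.smul_single c), f⟫_ℝ = (∫ x in Ω, ψ x • f x) c := by
  rw [inner_testL2_eq_sum, Finset.sum_eq_single c]
  · simp
  · intro b _ hb
    simp [hb]
  · simp

theorem setIntegral_inner_eq_integral {Φ Ψ : EuclideanSpace ℝ (Fin n) → EuclideanSpace ℝ (Fin d)}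
    (hΦ : IsTest Ω Φ) : ∫ x in Ω, ⟪Φ x, Ψ x⟫_ℝ = ∫ x, ⟪Φ x, Ψ x⟫_ℝ := by
  refine setIntegral_eq_integral_of_forall_compl_eq_zero fun x hx => ?_
  rw [image_eq_zero_of_notMem_tsupport fun h => hx (hΦ.2.2 h), inner_zero_left]

theorem integral_inner_partialDeriv
    {Φ Ψ : EuclideanSpace ℝ (Fin n) → EuclideanSpace ℝ (Fin d)} (hΦ : IsTest Ω Φ)
    (hΨ : IsTest Ω Ψ) (i : Fin n) :
    ∫ x, ⟪partialDeriv i Φ x, Ψ x⟫_ℝ = -∫ x, ⟪Φ x, partialDeriv i Ψ x⟫_ℝ := by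
  have hint : ∀ {A B : EuclideanSpace ℝ (Fin n) → EuclideanSpace ℝ (Fin d)}, IsTest Ω A →
      IsTest Ω B → Integrable (fun x => ⟪A x, B x⟫_ℝ) := fun {A B} hA hB => by
    refine (hA.1.continuous.inner hB.1.continuous).integrable_of_hasCompactSupport ?_
    refine hA.2.1.mono fun x hx => ?_
    contrapose! hx
    simp [Function.notMem_support.1 hx]
  have h := integral_bilinear_fderiv_right_eq_neg_left_of_integrable (μ := volume) (f := Φ) (g := Ψ)
    (v := EuclideanSpace.single i (1 : ℝ)) (B := innerSL ℝ)
    (hint (hΦ.partialDeriv i) hΨ) (hint hΦ (hΨ.partialDeriv i)) (hint hΦ hΨ)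
    (fun x _ => hΦ.1.differentiable (by simp) x) (fun x _ => hΨ.1.differentiable (by simp) x)
  rw [eq_neg_iff_add_eq_zero, add_comm, ← eq_neg_iff_add_eq_zero]
  exact h

/-- A continuous linear functional that vanishes on the jets of test fields vanishes on
`jetH10 Ω d`. -/
theorem eq_zero_of_mem_jetH10 (ℓ : Jet Ω d →L[ℝ] ℝ)
    (h : ∀ (p : Jet Ω d) (φ : EuclideanSpace ℝ (Fin n) → EuclideanSpace ℝ (Fin d))
      (hφ : IsTest Ω φ), p none = testL2 hφ → (∀ i, p (some i) = testL2 (hφ.partialDeriv i)) →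
      ℓ p = 0) {p : Jet Ω d} (hp : p ∈ jetH10 Ω d) : ℓ p = 0 := by
  have hle : jetH10 Ω d ≤ LinearMap.ker ℓ.toLinearMap := by
    refine Submodule.topologicalClosure_minimal _ (Submodule.span_le.2 ?_) ℓ.isClosed_ker
    rintro q ⟨φ, hφ, h0, hi⟩
    refine h q φ hφ (Lp.ext ?_) fun i => Lp.ext ?_
    · exact h0.trans hφ.memLp.coeFn_toLp.symm
    · exact (hi i).trans (hφ.partialDeriv i).memLp.coeFn_toLp.symm
  exact hle hp

/-- Integration by parts for two test fields takes place on the whole space, so no boundary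
regularity is needed; both sides are continuous in the jet, which extends it to the closure. -/
theorem inner_testL2_partialDeriv {p : Jet Ω d} (hp : p ∈ jetH10 Ω d)
    {Φ : EuclideanSpace ℝ (Fin n) → EuclideanSpace ℝ (Fin d)} (hΦ : IsTest Ω Φ) (i : Fin n) :
    ⟪testL2 (hΦ.partialDeriv i), p none⟫_ℝ = -⟪testL2 hΦ, p (some i)⟫_ℝ := by
  have h := eq_zero_of_mem_jetH10
    ((innerSL ℝ (testL2 (hΦ.partialDeriv i))).comp (comp Ω d none)
      + (innerSL ℝ (testL2 hΦ)).comp (comp Ω d (some i))) ?_ hp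
  · exact eq_neg_of_add_eq_zero_left h
  · intro q φ hφ h0 hi
    have hae : ∀ {A B : EuclideanSpace ℝ (Fin n) → EuclideanSpace ℝ (Fin d)} (hA : IsTest Ω A)
        (hB : IsTest Ω B), ⟪testL2 hA, testL2 hB⟫_ℝ = ∫ x, ⟪A x, B x⟫_ℝ := by
      intro A B hA hB
      rw [inner_testL2, ← setIntegral_inner_eq_integral hA]
      refine integral_congr_ae ?_
      filter_upwards [hB.memLp.coeFn_toLp] with x hx
      rw [testL2, hx]
    change ⟪testL2 (hΦ.partialDeriv i), q none⟫_ℝ + ⟪testL2 hΦ, q (some i)⟫_ℝ = 0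
    rw [h0, hi i, hae, hae, integral_inner_partialDeriv hΦ hφ]
    simp

theorem multiDeriv_single {F : Type*} [NormedAddCommGroup F] [NormedSpace ℝ F] (i : Fin n)
    (φ : EuclideanSpace ℝ (Fin n) → F) :
    multiDeriv (Pi.single i 1) φ = partialDeriv i φ := by
  have key : ∀ l : List (Fin n), l.Nodup →
      l.foldr (fun j ψ => (partialDeriv j)^[(Pi.single i 1 : Fin n → ℕ) j] ψ) φ
        = if i ∈ l then partialDeriv i φ else φ := by
    intro l hl
    induction l with
    | nil => simp
    | cons a l ih =>
      rw [List.nodup_cons] at hl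
      rw [List.foldr_cons, ih hl.2]
      rcases eq_or_ne a i with rfl | ha
      · simp [hl.1]
      · simp [ha.symm]
  simpa [multiDeriv] using key (List.finRange n) (List.nodup_finRange n)

theorem hasWeakDeriv_of_mem_jetH10 {p : Jet Ω d} (hp : p ∈ jetH10 Ω d) (i : Fin n) :
    HasWeakDeriv (Pi.single i 1) (p none) (p (some i)) := by
  intro ψ hψ
  have hs : ∑ j, (Pi.single i 1 : Fin n → ℕ) j = 1 := by simp
  rw [multiDeriv_single, hs, pow_one, neg_one_smul]
  -- The vector identity is read off componentwise, by pairing with the fields ψ e_c.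
  ext c
  have h := inner_testL2_partialDeriv hp (hψ.smul_single c) i
  have h2 : partialDeriv i (fun x => ψ x • EuclideanSpace.single c (1 : ℝ))
      = fun x => partialDeriv i ψ x • EuclideanSpace.single c (1 : ℝ) :=
    partialDeriv_comp_clm (hψ.1.differentiable (by simp))
      ((1 : ℝ →L[ℝ] ℝ).smulRight (EuclideanSpace.single c (1 : ℝ))) i
  have h3 : testL2 ((hψ.smul_single c).partialDeriv i)
      = testL2 ((hψ.partialDeriv i).smul_single c) := by
    simp only [testL2, h2]
  rw [h3, inner_testL2_smul_single (hψ.partialDeriv i), inner_testL2_smul_single hψ] at h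
  simpa using h

/-- The fundamental lemma of the calculus of variations on an open set. It identifies the value
chosen in `weakDeriv` with the gradient component of a jet. -/
theorem HasWeakDeriv.unique (hΩ : IsOpen Ω) {β : Fin n → ℕ} {f g g' : L2 Ω d}
    (h : HasWeakDeriv β f g) (h' : HasWeakDeriv β f g') : g = g' := by
  rw [← sub_eq_zero]
  refine Lp.ext ?_
  have hloc : LocallyIntegrableOn (⇑(g - g')) Ω volume := by
    have h1 : LocallyIntegrable (⇑(g - g')) (volume.restrict Ω) :=
      (Lp.memLp (g - g')).locallyIntegrable one_le_two
    exact locallyIntegrableOn_of_locallyIntegrable_restrict h1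
  have key := hΩ.ae_eq_zero_of_integral_contDiff_smul_eq_zero hloc fun ψ h1 h2 h3 => by
    have hψ : IsTest Ω ψ := ⟨h1, h2, h3⟩
    have e := (h ψ hψ).symm.trans (h' ψ hψ)
    have e2 : ∫ x in Ω, ψ x • g x = ∫ x in Ω, ψ x • g' x :=
      smul_right_injective _ (pow_ne_zero _ (by norm_num : (-1 : ℝ) ≠ 0)) e
    rw [← setIntegral_eq_integral_of_forall_compl_eq_zero (s := Ω) fun x hx => by
      rw [image_eq_zero_of_notMem_tsupport fun hh => hx (h3 hh), zero_smul]]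
    calc ∫ x in Ω, ψ x • (g - g') x = ∫ x in Ω, (ψ x • g x - ψ x • g' x) := by
          refine integral_congr_ae ?_
          filter_upwards [Lp.coeFn_sub g g'] with x hx
          rw [hx, Pi.sub_apply, smul_sub]
      _ = 0 := by
          rw [integral_sub (integrable_test_smul hψ g) (integrable_test_smul hψ g'), e2, sub_self]
  have h4 := (ae_restrict_iff' hΩ.measurableSet).2 key
  filter_upwards [h4, Lp.coeFn_zero (EuclideanSpace ℝ (Fin d)) 2 (volume.restrict Ω)] with x hx hx0
  rw [hx, hx0]; rfl

theorem HasWeakDeriv.weakDeriv_eq (hΩ : IsOpen Ω) {β : Fin n → ℕ} {f g : L2 Ω d}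
    (h : HasWeakDeriv β f g) : weakDeriv β f = g := by
  have hex : ∃ g, HasWeakDeriv β f g := ⟨g, h⟩
  rw [weakDeriv, dif_pos hex]
  exact hex.choose_spec.unique hΩ h

theorem sum_norm_grad_sq_le_sobolevNorm_sq (hΩ : IsOpen Ω) {p : Jet Ω d} (hp : p ∈ jetH10 Ω d) :
    ∑ i, ‖p (some i)‖ ^ 2 ≤ sobolevNorm 1 (p none) ^ 2 := by
  rw [sobolevNorm, Real.sq_sqrt (by positivity), Finset.sum_range_succ]
  refine le_add_of_nonneg_of_le (by positivity) ?_
  -- The unit multi-indices are distinct members of the order-one layer, so the gradient is part of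
  -- the Sobolev sum.
  have hinj : Function.Injective (fun i : Fin n => (Pi.single i 1 : Fin n → ℕ)) := by
    intro i j hij
    by_contra hne
    have := congrFun hij i
    simp [Pi.single_eq_of_ne hne] at this
  calc ∑ i, ‖p (some i)‖ ^ 2 = ∑ i, ‖weakDeriv (Pi.single i 1) (p none)‖ ^ 2 :=
        Finset.sum_congr rfl fun i _ => by
          rw [(hasWeakDeriv_of_mem_jetH10 hp i).weakDeriv_eq hΩ]
    _ = ∑ β ∈ Finset.univ.map ⟨_, hinj⟩, ‖weakDeriv β (p none)‖ ^ 2 := by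
        rw [Finset.sum_map]; rfl
    _ ≤ _ := by
        refine Finset.sum_le_sum_of_subset_of_nonneg ?_ fun _ _ _ => by positivity
        intro β hβ
        obtain ⟨i, -, rfl⟩ := Finset.mem_map.1 hβ
        rw [Finset.Nat.mem_antidiagonalTuple]
        simp

/-! ### The distributional Laplacian -/

theorem HasLaplacian.inner_testL2 {f g : L2 Ω d} (h : HasLaplacian f g)
    {φ : EuclideanSpace ℝ (Fin n) → EuclideanSpace ℝ (Fin d)} (hφ : IsTest Ω φ) :
    ∑ i, ⟪testL2 ((hφ.partialDeriv i).partialDeriv i), f⟫_ℝ = ⟪testL2 hφ, g⟫_ℝ := by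
  have hpc : ∀ c : Fin d, IsTest Ω (fun x => φ x c) := fun c =>
    hφ.comp_clm (EuclideanSpace.proj c)
  simp only [inner_testL2_eq_sum]
  rw [Finset.sum_comm]
  refine Finset.sum_congr rfl fun c _ => ?_
  rw [← h _ (hpc c)]
  have hd : ∀ i, partialDeriv i (partialDeriv i fun x => φ x c)
      = fun x => partialDeriv i (partialDeriv i φ) x c := fun i => by
    have h1 : partialDeriv i (fun x => φ x c) = fun x => partialDeriv i φ x c :=
      partialDeriv_comp_clm (hφ.1.differentiable (by simp)) (EuclideanSpace.proj (𝕜 := ℝ) c) i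
    rw [h1]
    exact partialDeriv_comp_clm ((hφ.partialDeriv i).1.differentiable (by simp))
      (EuclideanSpace.proj (𝕜 := ℝ) c) i
  simp only [laplacian_eq_sum_partialDeriv (hpc c).1, hd, Finset.sum_smul]
  have hint : ∀ i ∈ Finset.univ, Integrable
      (fun x => partialDeriv i (partialDeriv i φ) x c • f x) (volume.restrict Ω) := fun i _ =>
    integrable_test_smul
      (((hφ.partialDeriv i).partialDeriv i).comp_clm (EuclideanSpace.proj (𝕜 := ℝ) c)) f
  rw [integral_finsetSum _ hint]
  simp

/-- Green's formula `(∇f, ∇v) = -(Δf, v)` for `f, v ∈ H^1_0(Ω)^d`. -/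
theorem HasLaplacian.sum_inner_grad {p v : Jet Ω d} (hp : p ∈ jetH10 Ω d) (hv : v ∈ jetH10 Ω d)
    {g : L2 Ω d} (h : HasLaplacian (p none) g) :
    ∑ i, ⟪p (some i), v (some i)⟫_ℝ = -⟪g, v none⟫_ℝ := by
  have key := eq_zero_of_mem_jetH10
    (∑ i, (innerSL ℝ (p (some i))).comp (comp Ω d (some i))
      + (innerSL ℝ g).comp (comp Ω d none)) ?_ hv
  · simpa [add_eq_zero_iff_eq_neg] using key
  · intro q φ hφ h0 hi
    -- By density v may be a test field φ; both derivatives then fall on φ, where the distributional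
    -- definition applies.
    have e : ∀ i, ⟪p (some i), q (some i)⟫_ℝ
        = -⟪testL2 ((hφ.partialDeriv i).partialDeriv i), p none⟫_ℝ := fun i => by
      rw [hi i, inner_testL2_partialDeriv hp, neg_neg, real_inner_comm]
    have e2 := h.inner_testL2 hφ
    rw [← h0, real_inner_comm] at e2
    simp [e, e2]

theorem hasLaplacian_lap {f : L2 Ω d} (h : ∃ g, HasLaplacian f g) : HasLaplacian f (lap f) := by
  rw [lap, dif_pos h]
  exact h.choose_spec

end WeakDerivatives


/-! ### Error estimates -/

section Errors
variable {n d : ℕ} {Ω : Set (EuclideanSpace ℝ (Fin n))}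

/-- By Green's formula, f + δ² S g solves the variational problem with datum f, hence equals S f. -/
theorem sub_filterFn_of_hasLaplacian {δ : ℝ} (hδ : 0 < δ) {f g : L2 Ω d} (hf : f ∈ H10 Ω d)
    (h : HasLaplacian f g) :
    (1 - filterFn (jetH10 Ω d) δ hδ) f = (-δ ^ 2) • filterFn (jetH10 Ω d) δ hδ g := by
  obtain ⟨p, hp, rfl⟩ := hf
  have hsol : (⟨p, hp⟩ : jetH10 Ω d) + δ ^ 2 • filterSol (jetH10 Ω d) δ hδ g
      = filterSol (jetH10 Ω d) δ hδ (p none) := by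
    rw [eq_filterSol_iff_energyInner]
    intro v
    have h1 := HasLaplacian.sum_inner_grad hp v.2 h
    simp only [Submodule.coe_add, Submodule.coe_smul, energyInner_add_left, energyInner_smul_left,
      energyInner_filterSol _ hδ g v.2]
    rw [energyInner, h1]
    ring
  have h2 : p none + δ ^ 2 • filterFn (jetH10 Ω d) δ hδ g
      = filterFn (jetH10 Ω d) δ hδ (p none) :=
    congrArg (fun q : jetH10 Ω d => (q : Jet Ω d) none) hsol
  change p none - filterFn (jetH10 Ω d) δ hδ (p none) = _
  rw [← h2, neg_smul]
  abel

theorem one_sub_filterFn_pow {δ : ℝ} (hδ : 0 < δ) (u : L2 Ω d) (m : ℕ)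
    (hu : ∀ j < m, lap^[j] u ∈ H10 Ω d ∧ ∃ g, HasLaplacian (lap^[j] u) g) :
    ((1 - filterFn (jetH10 Ω d) δ hδ) ^ m) u
      = (-δ ^ 2) ^ m • ((filterFn (jetH10 Ω d) δ hδ) ^ m) (lap^[m] u) := by
  set S := filterFn (jetH10 Ω d) δ hδ with hS
  induction m with
  | zero => simp
  | succ m ih =>
    obtain ⟨h1, h2⟩ := hu m m.lt_succ_self
    have hc : Commute (1 - S) (S ^ m) := ((Commute.one_left S).sub_left (Commute.refl S)).pow_right m
    rw [pow_succ', mul_apply_eq_comp, ih fun j hj => hu j (hj.trans m.lt_succ_self), map_smul,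
      ← mul_apply_eq_comp, hc.eq, mul_apply_eq_comp,
      sub_filterFn_of_hasLaplacian hδ h1 (hasLaplacian_lap h2), map_smul, smul_smul,
      Function.iterate_succ_apply', ← hS, pow_succ S m, mul_apply_eq_comp, pow_succ (-δ ^ 2)]

theorem norm_filterFn_pow_apply_le (W : Submodule ℝ (Jet Ω d)) [CompleteSpace W] {δ : ℝ}
    (hδ : 0 < δ) (m : ℕ) (f : L2 Ω d) : ‖((filterFn W δ hδ) ^ m) f‖ ≤ ‖f‖ := by
  induction m with
  | zero => simp
  | succ m ih =>
    rw [pow_succ', mul_apply_eq_comp]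
    exact (norm_filterFn_le W hδ _).trans ih

/-- The regularization error of the exact filter. -/
theorem norm_sub_iterJet_le {δ : ℝ} (hδ : 0 < δ) (u : L2 Ω d) (J : ℕ)
    (hu : ∀ j ≤ J, lap^[j] u ∈ H10 Ω d ∧ ∃ g, HasLaplacian (lap^[j] u) g) :
    ‖u - (iterJet (jetH10 Ω d) δ hδ u J : Jet Ω d) none‖
      ≤ (δ ^ 2) ^ (J + 1) * ‖lap^[J + 1] u‖ := by
  rw [sub_iterJet_none, one_sub_filterFn_pow hδ u (J + 1) fun j hj => hu j (Nat.lt_succ_iff.1 hj),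
    norm_smul, norm_pow, norm_neg, Real.norm_of_nonneg (sq_nonneg δ)]
  gcongr
  exact norm_filterFn_pow_apply_le _ hδ _ _

/-- The H^1 rate, weighted by δ, controls the gradient part of the energy and the L² rate the rest.
Here |K| replaces K because K may be negative. -/
theorem ApproxProperty.exists_energy_le (hΩ : IsOpen Ω) {Xh : Submodule ℝ (L2 Ω d)}
    (hXh : Xh ≤ H10 Ω d) {k : ℕ} {K h : ℝ} (hh : 0 < h) (hX : ApproxProperty Xh k K h)
    {δ N : ℝ} (hδ : 0 < δ) {p : Jet Ω d} (hp : p ∈ jetH10 Ω d) (hm : MemSobolev (k + 1) (p none))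
    (hN : sobolevNorm (k + 1) (p none) ≤ N) :
    ∃ q ∈ jetOver Xh, energy δ (p - q) ≤ (|K| * (δ * h ^ k + h ^ (k + 1)) * N) ^ 2 := by
  have hs0 : 0 ≤ sobolevNorm (k + 1) (p none) := Real.sqrt_nonneg _
  obtain ⟨v, hv, h1, h2⟩ := hX (p none) ⟨p, hp, rfl⟩ hm
  obtain ⟨q, hq, rfl⟩ := hXh hv
  refine ⟨q, ⟨hq, hv⟩, ?_⟩
  have hb : ∀ m : ℕ, K * h ^ m * sobolevNorm (k + 1) (p none) ≤ |K| * h ^ m * N := fun m => by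
    have := le_abs_self K
    gcongr
  have h1' : ‖(p - q) none‖ ≤ |K| * h ^ (k + 1) * N := h1.trans (hb _)
  have h2' : sobolevNorm 1 ((p - q) none) ≤ |K| * h ^ k * N := h2.trans (hb _)
  have h3 := sum_norm_grad_sq_le_sobolevNorm_sq hΩ ((jetH10 Ω d).sub_mem hp hq)
  have h4 : sobolevNorm 1 ((p - q) none) ^ 2 ≤ (|K| * h ^ k * N) ^ 2 :=
    pow_le_pow_left₀ (Real.sqrt_nonneg _) h2' 2
  have h5 : ‖(p - q) none‖ ^ 2 ≤ (|K| * h ^ (k + 1) * N) ^ 2 :=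
    pow_le_pow_left₀ (norm_nonneg _) h1' 2
  have hN0 : 0 ≤ N := hs0.trans hN
  have h6 : 0 ≤ (δ * (|K| * h ^ k * N)) * (|K| * h ^ (k + 1) * N) := by positivity
  calc energy δ (p - q) ≤ δ ^ 2 * (|K| * h ^ k * N) ^ 2 + (|K| * h ^ (k + 1) * N) ^ 2 := by
        unfold energy
        gcongr
        exact h3.trans h4
    _ ≤ (|K| * (δ * h ^ k + h ^ (k + 1)) * N) ^ 2 := by
        have : (|K| * (δ * h ^ k + h ^ (k + 1)) * N) ^ 2
            = δ ^ 2 * (|K| * h ^ k * N) ^ 2 + (|K| * h ^ (k + 1) * N) ^ 2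
              + 2 * ((δ * (|K| * h ^ k * N)) * (|K| * h ^ (k + 1) * N)) := by ring
        linarith

/-- Propagation of the Galerkin error through the iteration. -/
theorem norm_iterJet_sub_le (W V : Submodule ℝ (Jet Ω d)) [CompleteSpace W] [CompleteSpace V]
    (hVW : V ≤ W) {δ M : ℝ} (hδ : 0 < δ) (hM : 0 ≤ M) (u : L2 Ω d) (J : ℕ)
    (happ : ∀ j ≤ J, ∃ q ∈ V, energy δ ((iterJet W δ hδ u j : Jet Ω d) - q) ≤ M ^ 2) :
    ‖(iterJet W δ hδ u J : Jet Ω d) none - (iterJet V δ hδ u J : Jet Ω d) none‖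
      ≤ (2 * J + 1) * M := by
  induction J with
  | zero =>
    obtain ⟨q, hq, hqe⟩ := happ 0 le_rfl
    have h1 := (norm_sq_le_energy δ _).trans
      ((energy_filterSol_sub_le W hVW hδ u hq).trans hqe)
    simpa [iterJet] using le_of_sq_le_sq h1 hM
  | succ J ih =>
    obtain ⟨q, hq, hqe⟩ := happ J J.le_succ
    obtain ⟨q', hq', hqe'⟩ := happ (J + 1) le_rfl
    set p := (iterJet W δ hδ u J : Jet Ω d) with hp
    set ph := (iterJet V δ hδ u J : Jet Ω d) with hph
    have hi := ih fun j hj => happ j (hj.trans J.le_succ)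
    have hcea := energy_filterSol_sub_le W hVW hδ (u - p none) (V.sub_mem hq' hq)
    -- The exact increment is u_{J+1} - u_J, so the difference q' - q of the approximants is an
    -- admissible competitor in Céa's lemma. The energy bound 2M² + 2M² gives the error 2M.
    have hsplit : (filterSol W δ hδ (u - p none) : Jet Ω d) - (q' - q)
        = ((iterJet W δ hδ u (J + 1) : Jet Ω d) - q') - (p - q) := by
      simp only [iterJet, Submodule.coe_add, ← hp]
      abel
    rw [hsplit] at hcea
    have h1 := (norm_sq_le_energy δ _).trans (hcea.trans (energy_sub_le δ _ _))
    have h2 : ‖filterFn W δ hδ (u - p none) - filterFn V δ hδ (u - p none)‖ ≤ 2 * M := by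
      refine le_of_sq_le_sq (h1.trans ?_) (by positivity)
      linarith
    have hrec : (iterJet W δ hδ u (J + 1) : Jet Ω d) none
          - (iterJet V δ hδ u (J + 1) : Jet Ω d) none
        = ((p none - ph none) - filterFn V δ hδ (p none - ph none))
          + (filterFn W δ hδ (u - p none) - filterFn V δ hδ (u - p none)) := by
      have e : filterFn V δ hδ (p none - ph none)
          = filterFn V δ hδ (u - ph none) - filterFn V δ hδ (u - p none) := by
        rw [← map_sub]; congr 1; abel
      rw [e]
      simp only [iterJet, Submodule.coe_add, PiLp.add_apply, ← hp, ← hph, filterFn_apply]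
      abel
    rw [hrec]
    calc _ ≤ ‖(p none - ph none) - filterFn V δ hδ (p none - ph none)‖
          + ‖filterFn W δ hδ (u - p none) - filterFn V δ hδ (u - p none)‖ := norm_add_le _ _
      _ ≤ (2 * J + 1) * M + 2 * M := add_le_add ((norm_sub_filterFn_le V hδ _).trans hi) h2
      _ = (2 * ((J + 1 : ℕ) : ℝ) + 1) * M := by push_cast; ring

end Errors

end Mitlar

end

/-! ### Assembly of the error bound -/

theorem mainTheorem4 {n d : ℕ} (Ω : Set (EuclideanSpace ℝ (Fin n))) (hΩ : IsOpen Ω)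
    (hΩb : Bornology.IsBounded Ω) (k J : ℕ) (K : ℝ) :
    ∃ C : ℝ, 0 < C ∧
      ∀ (Xh : Submodule ℝ (Mitlar.L2 Ω d)) [FiniteDimensional ℝ Xh], Xh ≤ Mitlar.H10 Ω d →
      ∀ (α δ : ℝ) (_ : 0 < α) (_ : α ≤ 1) (hδ : 0 < δ),
        ‖Mitlar.discMitlar Xh δ hδ α J‖ ≤ ((J : ℝ) + 1) / α ∧
        ∀ h : ℝ, 0 < h → Mitlar.ApproxProperty Xh k K h →
        ∀ u : Mitlar.L2 Ω d,
          (∀ j ≤ J, Mitlar.lap^[j] u ∈ Mitlar.H10 Ω d ∧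
            ∃ g, Mitlar.HasLaplacian (Mitlar.lap^[j] u) g) →
          (∀ j ≤ J, Mitlar.MemSobolev (k + 1)
            (Mitlar.contMitlar Ω d δ hδ α j (Mitlar.diffFilter Ω d δ hδ u))) →
        ∀ (ε ubar : Xh) (ε₀ : ℝ), ‖ε‖ ≤ ε₀ →
          Mitlar.discFilter Xh δ hδ u = ubar + ε →
          ‖u - (Mitlar.discMitlar Xh δ hδ α J ubar : Mitlar.L2 Ω d)‖ ≤
            ((J : ℝ) + 1) / α * ε₀
              + (α * δ ^ 2) ^ (J + 1) * ‖Mitlar.lap^[J + 1] u‖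
              + C * (√α * δ * h ^ k + h ^ (k + 1)) *
                (Finset.range (J + 1)).sup' Finset.nonempty_range_add_one
                  (fun j => Mitlar.sobolevNorm (k + 1)
                    (Mitlar.contMitlar Ω d δ hδ α j (Mitlar.diffFilter Ω d δ hδ u))) := by
  -- The Galerkin error is M at the start and grows by 2M in each of J steps; the added 1 only
  -- ensures C > 0 when K = 0.
  refine ⟨(2 * J + 1) * |K| + 1, by positivity, ?_⟩
  intro Xh _ hXh α δ hα hα1 hδ
  have hδ' : 0 < √α * δ := mul_pos (Real.sqrt_pos.2 hα) hδ
  refine ⟨ContinuousLinearMap.opNorm_le_bound _ (by positivity)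
    (Mitlar.norm_discMitlar_apply_le Xh hδ hα hα1 J), ?_⟩
  intro h hh hX u hu hreg ε ubar ε₀ hε hubar
  set N := (Finset.range (J + 1)).sup' Finset.nonempty_range_add_one
    (fun j => Mitlar.sobolevNorm (k + 1)
      (Mitlar.contMitlar Ω d δ hδ α j (Mitlar.diffFilter Ω d δ hδ u))) with hN
  have hle : ∀ j ≤ J, Mitlar.sobolevNorm (k + 1)
      (Mitlar.contMitlar Ω d δ hδ α j (Mitlar.diffFilter Ω d δ hδ u)) ≤ N := fun j hj =>
    Finset.le_sup' (fun j => Mitlar.sobolevNorm (k + 1)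
      (Mitlar.contMitlar Ω d δ hδ α j (Mitlar.diffFilter Ω d δ hδ u)))
      (Finset.mem_range_succ_iff.2 hj)
  have hN0 : 0 ≤ N := (Real.sqrt_nonneg _).trans (hle 0 J.zero_le)
  have hexact := Mitlar.norm_sub_iterJet_le hδ' u J hu
  have hgal := Mitlar.norm_iterJet_sub_le (Mitlar.jetH10 Ω d) (Mitlar.jetOver Xh) inf_le_left hδ'
    (M := |K| * (√α * δ * h ^ k + h ^ (k + 1)) * N) (by positivity) u J fun j hj => by
      refine hX.exists_energy_le hΩ hXh hh hδ' (Subtype.prop _) ?_ ?_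
      · rw [← Mitlar.contMitlar_diffFilter hδ hα hα1 hδ' u j]
        exact hreg j hj
      · rw [← Mitlar.contMitlar_diffFilter hδ hα hα1 hδ' u j]
        exact hle j hj
  have hdata : ‖Mitlar.discMitlar Xh δ hδ α J ε‖ ≤ ((J : ℝ) + 1) / α * ε₀ :=
    (Mitlar.norm_discMitlar_apply_le Xh hδ hα hα1 J ε).trans (by gcongr)
  rw [← Mitlar.discMitlar_discFilter Xh hδ hα hα1 hδ' u J, hubar, map_add,
    Submodule.coe_add] at hgal
  rw [mul_pow, Real.sq_sqrt hα.le] at hexact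
  set w := (Mitlar.iterJet (Mitlar.jetH10 Ω d) (√α * δ) hδ' u J : Mitlar.Jet Ω d) none
  set y := Mitlar.discMitlar Xh δ hδ α J ubar
  set z := Mitlar.discMitlar Xh δ hδ α J ε
  -- Data error, regularization error and Galerkin error, with y + z = D^h_J G^h u.
  have hsum : u - (y : Mitlar.L2 Ω d) = (z : Mitlar.L2 Ω d) + (u - w) + (w - (y + z)) := by abel
  have hextra : 0 ≤ (√α * δ * h ^ k + h ^ (k + 1)) * N := by positivity
  calc ‖u - (y : Mitlar.L2 Ω d)‖ ≤ ‖(z : Mitlar.L2 Ω d)‖ + ‖u - w‖ + ‖w - (y + z)‖ := by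
        rw [hsum]; exact norm_add₃_le
    _ ≤ ((J : ℝ) + 1) / α * ε₀ + (α * δ ^ 2) ^ (J + 1) * ‖Mitlar.lap^[J + 1] u‖
          + (2 * J + 1) * (|K| * (√α * δ * h ^ k + h ^ (k + 1)) * N) :=
        add_le_add (add_le_add hdata hexact) hgal
    _ ≤ _ := by
        rw [add_mul ((2 * (J : ℝ) + 1) * |K|) 1, add_mul _ _ N]
        linarith
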